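/- Let $G$ be a finite group with centre $Z(G)$, let $z=|Z(G)|$, and suppose that $G/Z(G)\cong D_{2n}$, the dihedral group of order $2n$, for some integer $n\ge 3$. Let $\Gamma_G$ be the commuting conjugacy class graph of $G$: its vertices are the conjugacy classes $x^G$ of the elements $x\in G\setminus Z(G)$, and two distinct vertices $x^G$, $y^G$ are adjacent if and only if some $x'\in x^G$ and $y'\in y^G$ commute. For a finite simple graph $\mathcal G$ with vertex set $V=\{v_1,\dots,v_m\}$, let $CN(\mathcal G)$ be the $m\times m$ matrix whose $(i,j)$ entry is the number of common neighbours of $v_i$ and $v_j$ if $i\ne j$, and $0$ if $i=j$; let $CNRS(\mathcal G)$ be the diagonal matrix whose $i$-th diagonal entry is the $i$-th row sum of $CN(\mathcal G)$; and let $\Delta(\mathcal G)=\operatorname{tr}(CNRS(\mathcal G))/|V|$. Put $$E_{CN}(\mathcal G)=\sum_{\lambda}|\lambda|,\qquad LE_{CN}(\mathcal G)=\sum_{\alpha}|\alpha-\Delta(\mathcal G)|,\qquad LE^+_{CN}(\mathcal G)=\sum_{\beta}|\beta-\Delta(\mathcal G)|,$$ where $\lambda$, $\alpha$, $\beta$ run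 over the eigenvalues, counted with multiplicity, of $CN(\mathcal G)$, of $CNRS(\mathcal G)-CN(\mathcal G)$ and of $CNRS(\mathcal G)+CN(\mathcal G)$, respectively. If $n=3$ and $z\ge 1$, or $n=5$ and $z=1$, then $$E_{CN}(\Gamma_G)=LE_{CN}(\Gamma_G)=LE^+_{CN}(\Gamma_G).$$ In all other cases, $$E_{CN}(\Gamma_G)<LE^+_{CN}(\Gamma_G)<LE_{CN}(\Gamma_G).$$ -/

import Mathlib

/-- The vertices of the commuting conjugacy class graph of `G`: the conjugacy classes `x^G`
of the elements `x ∈ G ∖ Z(G)`. -/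
abbrev CCCVertex (G : Type*) [Group G] : Type _ :=
  {c : ConjClasses G // ∃ x : G, x ∉ Subgroup.center G ∧ ConjClasses.mk x = c}

noncomputable instance CCCVertex.instFintype (G : Type*) [Group G] [Finite G] :
    Fintype (CCCVertex G) :=
  Fintype.ofFinite _

/-- The commuting conjugacy class graph of `G`: two distinct noncentral classes `x^G`, `y^G` are
adjacent if some `x' ∈ x^G` and `y' ∈ y^G` commute. -/
def cccGraph (G : Type*) [Group G] : SimpleGraph (CCCVertex G) where
  Adj a b := a ≠ b ∧ ∃ x ∈ a.1.carrier, ∃ y ∈ b.1.carrier, Commute x y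
  symm := ⟨fun _ _ h => ⟨h.1.symm, by
    obtain ⟨-, x, hx, y, hy, hxy⟩ := h
    exact ⟨y, hy, x, hx, hxy.symm⟩⟩⟩
  loopless := ⟨fun _ h => h.1 rfl⟩

noncomputable section

namespace SimpleGraph

variable {V : Type*}

open Classical in
/-- The common neighborhood matrix: for `i ≠ j` the entry is the number of vertices adjacent to
both `i` and `j` (such a vertex is automatically different from `i` and `j`), and the diagonal
is zero. -/
def cnMatrix (Γ : SimpleGraph V) : Matrix V V ℝ :=
  Matrix.of fun i j => if i ≠ j then ((Γ.commonNeighbors i j).ncard : ℝ) else 0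

theorem isHermitian_cnMatrix (Γ : SimpleGraph V) : Γ.cnMatrix.IsHermitian := by
  refine Matrix.IsHermitian.ext fun i j => ?_
  by_cases h : i = j
  · simp [cnMatrix, h]
  · simp [cnMatrix, h, Ne.symm h, Γ.commonNeighbors_symm j i]

variable [Fintype V]

open Classical in
/-- The diagonal matrix of the row sums of the common neighborhood matrix. -/
def cnRowSumMatrix (Γ : SimpleGraph V) : Matrix V V ℝ :=
  Matrix.diagonal fun i => ∑ k, Γ.cnMatrix i k

/-- The common neighborhood Laplacian matrix. -/
def cnLaplacian (Γ : SimpleGraph V) : Matrix V V ℝ :=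
  Γ.cnRowSumMatrix - Γ.cnMatrix

/-- The common neighborhood signless Laplacian matrix. -/
def cnSignlessLaplacian (Γ : SimpleGraph V) : Matrix V V ℝ :=
  Γ.cnRowSumMatrix + Γ.cnMatrix

open Classical in
/-- The multiset of the eigenvalues of a square real matrix, with (algebraic) multiplicities.
It is applied only to the symmetric matrices above (see the lemmas below), all of whose
eigenvalues are real and for which algebraic and geometric multiplicities agree. -/
def eigenvalueMultiset (M : Matrix V V ℝ) : Multiset ℝ := M.charpoly.roots

/-- The average `tr(CNRS) / |V|` of the row sums of the common neighborhood matrix. -/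
def cnDelta (Γ : SimpleGraph V) : ℝ :=
  Γ.cnRowSumMatrix.trace / (Fintype.card V : ℝ)

/-- The common neighborhood energy. -/
def cnEnergy (Γ : SimpleGraph V) : ℝ :=
  ((eigenvalueMultiset Γ.cnMatrix).map fun x => |x|).sum

/-- The common neighborhood Laplacian energy. -/
def cnLaplacianEnergy (Γ : SimpleGraph V) : ℝ :=
  ((eigenvalueMultiset Γ.cnLaplacian).map fun x => |x - Γ.cnDelta|).sum

/-- The common neighborhood signless Laplacian energy. -/
def cnSignlessLaplacianEnergy (Γ : SimpleGraph V) : ℝ :=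
  ((eigenvalueMultiset Γ.cnSignlessLaplacian).map fun x => |x - Γ.cnDelta|).sum

theorem isHermitian_cnRowSumMatrix (Γ : SimpleGraph V) : Γ.cnRowSumMatrix.IsHermitian := by
  classical
  unfold cnRowSumMatrix
  convert Matrix.isHermitian_diagonal (fun i => ∑ k, Γ.cnMatrix i k)

theorem isHermitian_cnLaplacian (Γ : SimpleGraph V) : Γ.cnLaplacian.IsHermitian :=
  Γ.isHermitian_cnRowSumMatrix.sub Γ.isHermitian_cnMatrix

theorem isHermitian_cnSignlessLaplacian (Γ : SimpleGraph V) :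
    Γ.cnSignlessLaplacian.IsHermitian :=
  Γ.isHermitian_cnRowSumMatrix.add Γ.isHermitian_cnMatrix

end SimpleGraph

end

/-! Elements over rotations of the dihedral quotient commute with one another. A noncentral one
never commutes with an element over a reflection, and two elements over reflections commute only
over the same reflection. So Γ_G is a disjoint union of cliques: one of size (n-1)z/2 from the
rotations and, from the reflections, one of size z (n odd) or two of size z/2 (n even); see
`cccGraph_adj_iff`, `two_mul_card_type_zero` and `card_type_succ`.

On a clique of size c the common neighbourhood matrix is (c-2)(J-I), so all three spectra are
explicit by `sum_map_eigenvalueMultiset_of_blocks`. Equality occurs when the two cliques have equal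
size (n = 3) or sizes 2 and 1, where every matrix vanishes (n = 5, z = 1).

Otherwise the big clique has m times the size b of each of the k small ones. With A and B the row
sums on the big and small cliques and D their weighted mean, E = 2A + 2kB.
`energy_lt_of_cliqueUnion` rests on A - D > kB, a form of A > (m+k+1)B, and on D being large enough
to settle all signs but one. -/

/-! ### Spectra of block matrices with blocks αI + βJ. -/

open Polynomial in
/-- The characteristic polynomial of `α I + β J`. -/
theorem Matrix.charpoly_scalar_add_const {V R : Type*} [Fintype V] [DecidableEq V] [Nonempty V]
    [CommRing R] [Nontrivial R] (α β : R) :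
    (Matrix.of fun i j : V => (if i = j then α else 0) + β).charpoly =
      (X - C α) ^ (Fintype.card V - 1) * (X - C (α + Fintype.card V * β)) := by
  set M := Matrix.of fun i j : V => (if i = j then α else 0) + β
  -- Removing αI leaves a rank-one matrix, whose characteristic polynomial is known; composing with
  -- X - α undoes the shift.
  have h : M - Matrix.scalar V α = Matrix.vecMulVec (fun _ => β) (fun _ => 1) := by
    ext i j
    by_cases hij : i = j <;> simp [M, hij, Matrix.vecMulVec_apply]
  have h1 := Matrix.charpoly_sub_scalar M α
  rw [h, Matrix.charpoly_vecMulVec] at h1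
  have h2 := congrArg (fun p : R[X] => p.comp (X - C α)) h1
  simp only [Polynomial.comp_assoc] at h2
  simp only [add_comp, X_comp, C_comp, sub_add_cancel, comp_X] at h2
  rw [← h2]
  obtain ⟨k, hk⟩ := Nat.exists_eq_succ_of_ne_zero (Fintype.card_ne_zero (α := V))
  simp [hk, dotProduct, smul_eq_C_mul]
  ring

namespace SimpleGraph

open Polynomial in
/-- Summing a function over the eigenvalues of a matrix that is, up to a permutation of the
indices, block diagonal with blocks `α I + β J`. -/
theorem sum_map_eigenvalueMultiset_of_blocks {V ι : Type*} [Fintype V] [Fintype ι]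
    [LinearOrder ι] (f : V → ι) (hf : Function.Surjective f) (M : Matrix V V ℝ) (α β : ι → ℝ)
    (hM : ∀ u v, u ≠ v → M u v = if f u = f v then β (f u) else 0)
    (hM' : ∀ u, M u u = α (f u) + β (f u)) (g : ℝ → ℝ) :
    ((eigenvalueMultiset M).map g).sum =
      ∑ i, (((Nat.card (f ⁻¹' {i}) : ℝ) - 1) * g (α i) +
        g (α i + Nat.card (f ⁻¹' {i}) * β i)) := by
  classical
  have hpos : ∀ i, 0 < Nat.card (f ⁻¹' {i}) := fun i => by
    obtain ⟨v, hv⟩ := hf i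
    have : Nonempty (f ⁻¹' {i}) := ⟨⟨v, hv⟩⟩
    exact Nat.card_pos
  have hblock : ∀ i, (M.toSquareBlock f i).charpoly =
      (X - C (α i)) ^ (Nat.card (f ⁻¹' {i}) - 1) *
        (X - C (α i + Nat.card (f ⁻¹' {i}) * β i)) := by
    intro i
    obtain ⟨v, hv⟩ := hf i
    have : Nonempty {a // f a = i} := ⟨⟨v, hv⟩⟩
    have hc : Nat.card (f ⁻¹' {i}) = Fintype.card {a // f a = i} := by
      rw [← Nat.card_eq_fintype_card]; rfl
    rw [hc, ← Matrix.charpoly_scalar_add_const]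
    congr 1
    ext ⟨a, ha⟩ ⟨b, hb⟩
    by_cases hab : a = b
    · subst hab; simp [Matrix.toSquareBlock_def, hM', ha]
    · simp [Matrix.toSquareBlock_def, hM a b hab, ha, hb, hab]
  -- The order on ι serves only here: block diagonal is treated as block triangular.
  have htri : M.BlockTriangular f := fun u v h => by
    rw [hM u v (fun e => by simp [e] at h), if_neg (ne_of_gt h)]
  have hchar : M.charpoly = ∏ i, ((X - C (α i)) ^ (Nat.card (f ⁻¹' {i}) - 1) *
        (X - C (α i + Nat.card (f ⁻¹' {i}) * β i))) := by
    rw [htri.charpoly, Finset.image_univ_of_surjective hf]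
    exact Finset.prod_congr rfl fun i _ => hblock i
  have hne : ∀ i, (X - C (α i)) ^ (Nat.card (f ⁻¹' {i}) - 1) *
        (X - C (α i + Nat.card (f ⁻¹' {i}) * β i)) ≠ 0 := fun i =>
    mul_ne_zero (pow_ne_zero _ (X_sub_C_ne_zero _)) (X_sub_C_ne_zero _)
  have hroots : eigenvalueMultiset M = ∑ i, ((Nat.card (f ⁻¹' {i}) - 1) • {α i} +
      {α i + Nat.card (f ⁻¹' {i}) * β i}) := by
    have e : eigenvalueMultiset M = M.charpoly.roots := by unfold eigenvalueMultiset; congr!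
    rw [e, hchar, roots_prod _ _ (Finset.prod_ne_zero_iff.2 fun i _ => hne i), Multiset.bind,
      Multiset.join]
    refine Finset.sum_congr rfl fun i _ => ?_
    rw [roots_mul (hne i), roots_pow, roots_X_sub_C, roots_X_sub_C]
  rw [hroots]
  have := map_sum ((Multiset.sumAddMonoidHom (M := ℝ)).comp (Multiset.mapAddMonoidHom g))
    (fun i => ((Nat.card (f ⁻¹' {i}) - 1) • {α i} +
      {α i + Nat.card (f ⁻¹' {i}) * β i} : Multiset ℝ)) Finset.univ
  simp only [AddMonoidHom.comp_apply, Multiset.coe_mapAddMonoidHom,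
    Multiset.coe_sumAddMonoidHom] at this
  rw [this]
  refine Finset.sum_congr rfl fun i _ => ?_
  rw [Multiset.map_add, Multiset.sum_add, Multiset.map_nsmul, Multiset.sum_nsmul]
  rw [Multiset.map_singleton, Multiset.sum_singleton, nsmul_eq_mul, Nat.cast_sub (hpos i)]
  simp

theorem cnMatrix_self {V : Type*} (Γ : SimpleGraph V) (u : V) : Γ.cnMatrix u u = 0 := by
  simp [cnMatrix]

/-! ### Disjoint unions of cliques. -/

section CliqueUnion

variable {V ι : Type*} [Fintype V] [Fintype ι] [LinearOrder ι] (Γ : SimpleGraph V) (f : V → ι)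

omit [Fintype ι] in
theorem cnMatrix_of_cliqueUnion (hΓ : ∀ u v, Γ.Adj u v ↔ u ≠ v ∧ f u = f v) {u v : V}
    (h : u ≠ v) :
    Γ.cnMatrix u v = if f u = f v then (Nat.card (f ⁻¹' {f u}) : ℝ) - 2 else 0 := by
  classical
  have e : Γ.commonNeighbors u v = {w | (u ≠ w ∧ f u = f w) ∧ (v ≠ w ∧ f v = f w)} := by
    ext w
    rw [mem_commonNeighbors, hΓ, hΓ]; rfl
  simp only [cnMatrix, Matrix.of_apply, ne_eq, h, not_false_eq_true, if_true]
  rw [e]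
  split_ifs with hf
  · have e2 : {w | (u ≠ w ∧ f u = f w) ∧ (v ≠ w ∧ f v = f w)} = (f ⁻¹' {f u}) \ {u, v} := by
      ext w
      simp only [Set.mem_ofPred_eq, Set.mem_sdiff, Set.mem_preimage, Set.mem_singleton_iff,
        Set.mem_insert_iff, ← hf]
      grind
    have hs : ({u, v} : Set V) ⊆ f ⁻¹' {f u} := by
      rintro w (rfl | rfl) <;> simp [hf]
    have h2 := Set.ncard_le_ncard hs
    rw [Set.ncard_pair h] at h2
    rw [e2, Set.ncard_sdiff hs, Set.ncard_pair h, Nat.cast_sub h2]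
    rfl
  · have : {w | (u ≠ w ∧ f u = f w) ∧ (v ≠ w ∧ f v = f w)} = ∅ := by
      ext w
      simp only [Set.mem_ofPred_eq, Set.mem_empty_iff_false, iff_false]
      rintro ⟨⟨-, h1⟩, -, h2⟩
      exact hf (h1.trans h2.symm)
    simp [this]

omit [Fintype ι] in
theorem cnMatrix_rowSum_of_cliqueUnion (hΓ : ∀ u v, Γ.Adj u v ↔ u ≠ v ∧ f u = f v) (u : V) :
    ∑ v, Γ.cnMatrix u v =
      ((Nat.card (f ⁻¹' {f u}) : ℝ) - 1) * ((Nat.card (f ⁻¹' {f u}) : ℝ) - 2) := by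
  classical
  set c : ℝ := (Nat.card (f ⁻¹' {f u}) : ℝ) - 2 with hc
  have h1 : ∀ v, Γ.cnMatrix u v = (if f v = f u then c else 0) - if u = v then c else 0 := by
    intro v
    by_cases h : u = v
    · subst h; simp [cnMatrix_self]
    · rw [cnMatrix_of_cliqueUnion Γ f hΓ h]; simp [h, eq_comm, hc]
  have hcard : ((Finset.univ.filter fun v => f v = f u).card : ℝ) = Nat.card (f ⁻¹' {f u}) := by
    rw [Nat.card_eq_fintype_card, Fintype.card_subtype]; simp
  rw [Finset.sum_congr rfl fun v _ => h1 v, Finset.sum_sub_distrib, ← Finset.sum_filter,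
    Finset.sum_const, nsmul_eq_mul, hcard]
  simp
  ring

theorem cnDelta_of_cliqueUnion (hΓ : ∀ u v, Γ.Adj u v ↔ u ≠ v ∧ f u = f v) :
    Γ.cnDelta = (∑ i, (Nat.card (f ⁻¹' {i}) : ℝ) * (((Nat.card (f ⁻¹' {i}) : ℝ) - 1) *
      ((Nat.card (f ⁻¹' {i}) : ℝ) - 2))) / ∑ i, (Nat.card (f ⁻¹' {i}) : ℝ) := by
  classical
  have hsum : ∀ g : ι → ℝ, ∑ v, g (f v) = ∑ i, (Nat.card (f ⁻¹' {i}) : ℝ) * g i := by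
    intro g
    rw [← Finset.sum_fiberwise Finset.univ f]
    refine Finset.sum_congr rfl fun i _ => ?_
    rw [Finset.sum_congr rfl (g := fun _ => g i)
      (fun v hv => by rw [(Finset.mem_filter.1 hv).2]), Finset.sum_const, nsmul_eq_mul,
      Nat.card_eq_fintype_card, Fintype.card_subtype]
    simp
  have hN := hsum fun _ => 1
  simp only [Finset.sum_const, Finset.card_univ, nsmul_eq_mul, mul_one] at hN
  rw [cnDelta, hN]
  congr 1
  have : Γ.cnRowSumMatrix.trace = ∑ u, ∑ v, Γ.cnMatrix u v := by
    simp [cnRowSumMatrix, Matrix.trace]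
  rw [this, ← hsum fun i => ((Nat.card (f ⁻¹' {i}) : ℝ) - 1) * ((Nat.card (f ⁻¹' {i}) : ℝ) - 2)]
  exact Finset.sum_congr rfl fun u _ => cnMatrix_rowSum_of_cliqueUnion Γ f hΓ u

/-- A clique of size c contributes -(c-2), c-1 times, and (c-1)(c-2) once. For c = 1 the spurious
c-2 = -1 is harmless, since it always comes with a factor c-1. -/
theorem cnEnergy_of_cliqueUnion (hf : Function.Surjective f)
    (hΓ : ∀ u v, Γ.Adj u v ↔ u ≠ v ∧ f u = f v) :
    Γ.cnEnergy = ∑ i, (((Nat.card (f ⁻¹' {i}) : ℝ) - 1) * |-((Nat.card (f ⁻¹' {i}) : ℝ) - 2)| +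
      |((Nat.card (f ⁻¹' {i}) : ℝ) - 1) * ((Nat.card (f ⁻¹' {i}) : ℝ) - 2)|) := by
  rw [cnEnergy, sum_map_eigenvalueMultiset_of_blocks f hf _
    (fun i => -((Nat.card (f ⁻¹' {i}) : ℝ) - 2)) (fun i => (Nat.card (f ⁻¹' {i}) : ℝ) - 2)]
  · refine Finset.sum_congr rfl fun i _ => ?_
    congr 2; ring
  · intro u v h
    rw [cnMatrix_of_cliqueUnion Γ f hΓ h]
  · intro u
    rw [cnMatrix_self]; ring

theorem cnLaplacianEnergy_of_cliqueUnion (hf : Function.Surjective f)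
    (hΓ : ∀ u v, Γ.Adj u v ↔ u ≠ v ∧ f u = f v) :
    Γ.cnLaplacianEnergy = ∑ i, (((Nat.card (f ⁻¹' {i}) : ℝ) - 1) *
      |(Nat.card (f ⁻¹' {i}) : ℝ) * ((Nat.card (f ⁻¹' {i}) : ℝ) - 2) - Γ.cnDelta| +
      |0 - Γ.cnDelta|) := by
  classical
  rw [cnLaplacianEnergy, sum_map_eigenvalueMultiset_of_blocks f hf _
    (fun i => (Nat.card (f ⁻¹' {i}) : ℝ) * ((Nat.card (f ⁻¹' {i}) : ℝ) - 2))
    (fun i => -((Nat.card (f ⁻¹' {i}) : ℝ) - 2))]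
  · refine Finset.sum_congr rfl fun i _ => ?_
    congr 3; ring
  · intro u v h
    simp only [cnLaplacian, cnRowSumMatrix, Matrix.sub_apply, Matrix.diagonal_apply_ne _ h]
    rw [cnMatrix_of_cliqueUnion Γ f hΓ h]
    split_ifs <;> ring
  · intro u
    simp only [cnLaplacian, cnRowSumMatrix, Matrix.sub_apply, Matrix.diagonal_apply_eq]
    rw [cnMatrix_self, cnMatrix_rowSum_of_cliqueUnion Γ f hΓ]; ring

theorem cnSignlessLaplacianEnergy_of_cliqueUnion (hf : Function.Surjective f)
    (hΓ : ∀ u v, Γ.Adj u v ↔ u ≠ v ∧ f u = f v) :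
    Γ.cnSignlessLaplacianEnergy = ∑ i, (((Nat.card (f ⁻¹' {i}) : ℝ) - 1) *
      |((Nat.card (f ⁻¹' {i}) : ℝ) - 2) ^ 2 - Γ.cnDelta| +
      |2 * (((Nat.card (f ⁻¹' {i}) : ℝ) - 1) * ((Nat.card (f ⁻¹' {i}) : ℝ) - 2)) -
        Γ.cnDelta|) := by
  classical
  rw [cnSignlessLaplacianEnergy, sum_map_eigenvalueMultiset_of_blocks f hf _
    (fun i => ((Nat.card (f ⁻¹' {i}) : ℝ) - 2) ^ 2)
    (fun i => (Nat.card (f ⁻¹' {i}) : ℝ) - 2)]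
  · refine Finset.sum_congr rfl fun i _ => ?_
    congr 3; ring
  · intro u v h
    simp only [cnSignlessLaplacian, cnRowSumMatrix, Matrix.add_apply, Matrix.diagonal_apply_ne _ h]
    rw [cnMatrix_of_cliqueUnion Γ f hΓ h, zero_add]
  · intro u
    simp only [cnSignlessLaplacian, cnRowSumMatrix, Matrix.add_apply, Matrix.diagonal_apply_eq]
    rw [cnMatrix_self, cnMatrix_rowSum_of_cliqueUnion Γ f hΓ]; ring

end CliqueUnion

end SimpleGraph

/-! ### The real inequality. -/

/-- Comparison of the three energies of the disjoint union of a clique on `m * b` vertices and `k`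
cliques on `b` vertices, where `D` is the average row sum. -/
theorem energy_lt_of_cliqueUnion {m b k D : ℝ} (hb : b = 1 ∨ 2 ≤ b)
    (hmk : k = 1 ∧ (3 ≤ m ∨ m = 2 ∧ 2 ≤ b) ∨ k = 2 ∧ 3 ≤ m)
    (hD : (m + k) * D = m * ((m * b - 1) * (m * b - 2)) + k * ((b - 1) * (b - 2))) :
    ((m * b - 1) * |-(m * b - 2)| + |(m * b - 1) * (m * b - 2)|) +
        k * ((b - 1) * |-(b - 2)| + |(b - 1) * (b - 2)|) <
      ((m * b - 1) * |(m * b - 2) ^ 2 - D| + |2 * ((m * b - 1) * (m * b - 2)) - D|) +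
        k * ((b - 1) * |(b - 2) ^ 2 - D| + |2 * ((b - 1) * (b - 2)) - D|) ∧
    ((m * b - 1) * |(m * b - 2) ^ 2 - D| + |2 * ((m * b - 1) * (m * b - 2)) - D|) +
        k * ((b - 1) * |(b - 2) ^ 2 - D| + |2 * ((b - 1) * (b - 2)) - D|) <
      ((m * b - 1) * |m * b * (m * b - 2) - D| + |0 - D|) +
        k * ((b - 1) * |b * (b - 2) - D| + |0 - D|) := by
  have hb1 : 1 ≤ b := by rcases hb with h | h <;> linarith
  have hm2 : 2 ≤ m := by rcases hmk with ⟨_, h | h⟩ | h <;> grind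
  have hk0 : 0 < k := by rcases hmk with h | h <;> linarith [h.1]
  have hsq : m + k + 1 ≤ m ^ 2 := by
    rcases hmk with ⟨rfl, h⟩ | ⟨rfl, h⟩
    · nlinarith
    · nlinarith
  set a := m * b with ha
  set A := (a - 1) * (a - 2) with hA
  set B := (b - 1) * (b - 2) with hB
  have hB0 : 0 ≤ B := by
    rcases hb with rfl | h
    · simp [hB]
    · exact mul_nonneg (by linarith) (by linarith)
  have ha2 : 2 < a := by
    rcases hmk with ⟨_, h | h⟩ | h
    · nlinarith
    · nlinarith
    · nlinarith
  have hA0 : 0 < A := mul_pos (by linarith) (by linarith)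
  have hAB : (m + k + 1) * B < A := by
    have h1 : A - m ^ 2 * B = 3 * m * (m - 1) * (b - 1) + (m - 1) * (m - 2) := by
      rw [hA, hB, ha]; ring
    have h2 : 0 < 3 * m * (m - 1) * (b - 1) + (m - 1) * (m - 2) := by
      rcases lt_or_eq_of_le hm2 with h | h
      · have : 0 < (m - 1) * (m - 2) := mul_pos (by linarith) (by linarith)
        have : 0 ≤ 3 * m * (m - 1) * (b - 1) :=
          mul_nonneg (mul_nonneg (by linarith) (by linarith)) (by linarith)
        linarith
      · subst h
        have : 2 ≤ b := by grind
        linarith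
    nlinarith [mul_le_mul_of_nonneg_right hsq hB0]
  have hmkp : 0 < m + k := by linarith
  have hAD : k * B < A - D := by
    have : 0 < (m + k) * (A - D - k * B) := by
      have e : (m + k) * (A - D - k * B) = k * (A - (m + k + 1) * B) := by
        linear_combination -hD
      rw [e]
      exact mul_pos hk0 (by linarith)
    linarith [(mul_pos_iff_of_pos_left hmkp).1 this]
  have hkB : 0 ≤ k * B := mul_nonneg hk0.le hB0
  have hAB' : 0 ≤ A - B := by nlinarith
  -- The bound is the value of D at m = 2, k = 1. It settles the signs of all terms coming from the
  -- small cliques.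
  have hD1 : 3 * b ^ 2 - 5 * b + 2 ≤ D := by
    rcases hmk with ⟨rfl, h⟩ | ⟨rfl, h⟩
    · have h1 : (m + 1) * (2 * A + B) ≤ (m + 1) * (3 * D) := by
        nlinarith [mul_nonneg (sub_nonneg.2 hm2) hAB']
      have h2 := le_of_mul_le_mul_left h1 hmkp
      have h3 : (2 * b - 1) * (2 * b - 2) ≤ A := by
        rw [hA, ha]
        exact mul_le_mul (by nlinarith) (by nlinarith) (by nlinarith) (by nlinarith)
      nlinarith
    · have h1 : (m + 2) * (3 * A + 2 * B) ≤ (m + 2) * (5 * D) := by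
        nlinarith [mul_nonneg (sub_nonneg.2 h) hAB']
      have h2 := le_of_mul_le_mul_left h1 hmkp
      have h3 : (3 * b - 1) * (3 * b - 2) ≤ A := by
        rw [hA, ha]
        exact mul_le_mul (by nlinarith) (by nlinarith) (by nlinarith) (by nlinarith)
      nlinarith
  have hD0 : 0 ≤ D := by nlinarith
  have hDB : 2 * B ≤ D := by nlinarith
  have hDb : b * (b - 2) ≤ D := by nlinarith
  have hDb2 : (b - 1) * |(b - 2) ^ 2 - D| = (b - 1) * (D - (b - 2) ^ 2) := by
    rcases hb with rfl | h
    · simp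
    · rw [abs_of_nonpos (by nlinarith), neg_sub]
  have htr : (a + k * b) * D = a * A + k * b * B := by
    rw [ha]; linear_combination b * hD
  have hE : (b - 1) * |-(b - 2)| + |B| = 2 * B := by
    rw [abs_of_nonneg hB0, abs_neg]
    rcases hb with rfl | h
    · simp [hB]
    · rw [abs_of_nonneg (by linarith), hB]; ring
  have hEa : (a - 1) * |-(a - 2)| + |A| = 2 * A := by
    rw [abs_of_pos hA0, abs_neg, abs_of_nonneg (by linarith), hA]; ring
  have haA : A = a ^ 2 - 3 * a + 2 := by rw [hA]; ring
  have hbB : B = b ^ 2 - 3 * b + 2 := by rw [hB]; ring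
  rw [hE, hEa, hDb2, abs_of_nonpos (show 2 * B - D ≤ 0 by linarith),
    abs_of_nonneg (show 0 ≤ 2 * A - D by linarith), zero_sub, abs_neg, abs_of_nonneg hD0,
    abs_of_nonpos (show b * (b - 2) - D ≤ 0 by linarith),
    abs_of_nonneg (show 0 ≤ a * (a - 2) - D by linarith)]
  constructor
  -- Only the sign of (a-2)² - D is unknown. Bounding its absolute value below by D - (a-2)², the
  -- trace identity `htr` gives LE⁺ ≥ 4A - 2D, which exceeds 2A + 2kB by `hAD`.
  · have h1 : (a - 1) * (D - (a - 2) ^ 2) ≤ (a - 1) * |(a - 2) ^ 2 - D| := by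
      refine mul_le_mul_of_nonneg_left ?_ (by linarith)
      rw [abs_sub_comm]; exact le_abs_self _
    have h2 : (a - 1) * (D - (a - 2) ^ 2) + (2 * A - D) +
        k * ((b - 1) * (D - (b - 2) ^ 2) + -(2 * B - D)) = 4 * A - 2 * D := by
      rw [haA, hbB] at *
      linear_combination htr
    linarith
  -- LE - LE⁺ equals 2D in the first case and 2(a-2)(A-D) in the second.
  · rcases le_total D ((a - 2) ^ 2) with h | h
    · rw [abs_of_nonneg (by linarith)]
      have hDp : 0 < D := by
        have : 0 < (m + k) * D := by
          rw [hD]; linarith [mul_pos (show 0 < m by linarith) hA0]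
        exact (mul_pos_iff_of_pos_left hmkp).1 this
      rw [haA, hbB] at *
      nlinarith
    · rw [abs_of_nonpos (by linarith)]
      have := mul_pos (sub_pos.2 ha2) (show 0 < A - D by linarith)
      rw [haA, hbB] at *
      nlinarith

/-! ### Energies of one clique together with k cliques of a common size. -/

namespace SimpleGraph

section

variable {V : Type*} [Fintype V] {k : ℕ} (Γ : SimpleGraph V) (f : V → Fin (k + 1))
  (hf : Function.Surjective f) (hΓ : ∀ u v, Γ.Adj u v ↔ u ≠ v ∧ f u = f v) {b : ℕ} {m : ℝ}
  (h0 : (Nat.card (f ⁻¹' {0}) : ℝ) = m * b) (h1 : ∀ j : Fin k, Nat.card (f ⁻¹' {j.succ}) = b)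

include hΓ h0 h1 in
theorem cnDelta_of_cliques (hb : 1 ≤ b) (hm : 0 < m + k) :
    (m + k) * Γ.cnDelta = m * ((m * b - 1) * (m * b - 2)) + k * (((b : ℝ) - 1) * (b - 2)) := by
  have hb' : (b : ℝ) ≠ 0 := by positivity
  rw [cnDelta_of_cliqueUnion Γ f hΓ]
  simp only [Fin.sum_univ_succ, h1, h0, Finset.sum_const, Finset.card_univ, Fintype.card_fin,
    nsmul_eq_mul]
  have : m * b + k * b ≠ 0 := by rw [← add_mul]; exact mul_ne_zero hm.ne' hb'
  field_simp

include hf hΓ h0 h1 in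
theorem cnEnergy_lt_of_cliques
    (hmk : k = 1 ∧ (3 ≤ m ∨ m = 2 ∧ 2 ≤ b) ∨ k = 2 ∧ 3 ≤ m) (hb : 1 ≤ b) :
    Γ.cnEnergy < Γ.cnSignlessLaplacianEnergy ∧
      Γ.cnSignlessLaplacianEnergy < Γ.cnLaplacianEnergy := by
  rw [cnEnergy_of_cliqueUnion Γ f hf hΓ, cnLaplacianEnergy_of_cliqueUnion Γ f hf hΓ,
    cnSignlessLaplacianEnergy_of_cliqueUnion Γ f hf hΓ]
  simp only [Fin.sum_univ_succ, h1, h0, Finset.sum_const, Finset.card_univ, Fintype.card_fin,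
    nsmul_eq_mul]
  refine energy_lt_of_cliqueUnion ?_ ?_ (cnDelta_of_cliques Γ f hΓ h0 h1 hb ?_)
  · rcases hb.eq_or_lt with h | h
    · exact .inl (by exact_mod_cast h.symm)
    · exact .inr (by exact_mod_cast h)
  · rcases hmk with ⟨rfl, h⟩ | ⟨rfl, h⟩
    · exact .inl ⟨by norm_num, h.imp_right fun h => ⟨h.1, by exact_mod_cast h.2⟩⟩
    · exact .inr ⟨by norm_num, h⟩
  · rcases hmk with ⟨rfl, h | h⟩ | ⟨rfl, h⟩
    · norm_num; linarith
    · norm_num; linarith [h.1]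
    · norm_num; linarith

end

section

variable {V : Type*} [Fintype V] (Γ : SimpleGraph V) (f : V → Fin 2)
  (hf : Function.Surjective f) (hΓ : ∀ u v, Γ.Adj u v ↔ u ≠ v ∧ f u = f v)

include hf hΓ

/-- All row sums equal Δ, so subtracting ΔI from the two Laplacians leaves -CN and CN. -/
theorem cnEnergy_eq_of_two_cliques {b : ℕ} (hb : 1 ≤ b)
    (h0 : Nat.card (f ⁻¹' {0}) = b) (h1 : Nat.card (f ⁻¹' {1}) = b) :
    Γ.cnEnergy = Γ.cnLaplacianEnergy ∧ Γ.cnLaplacianEnergy = Γ.cnSignlessLaplacianEnergy := by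
  have hD := cnDelta_of_cliques (b := b) (m := 1) Γ f hΓ (by simp [h0])
    (fun j => by rw [Subsingleton.elim j 0]; exact h1) hb (by norm_num)
  have hD : Γ.cnDelta = ((b : ℝ) - 1) * (b - 2) := by push_cast at hD; linarith
  rw [cnEnergy_of_cliqueUnion Γ f hf hΓ, cnLaplacianEnergy_of_cliqueUnion Γ f hf hΓ,
    cnSignlessLaplacianEnergy_of_cliqueUnion Γ f hf hΓ]
  simp only [Fin.sum_univ_two, h0, h1, hD]
  have e1 : (b : ℝ) * (b - 2) - (b - 1) * (b - 2) = b - 2 := by ring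
  have e2 : ((b : ℝ) - 2) ^ 2 - (b - 1) * (b - 2) = -(b - 2) := by ring
  have e3 : 2 * (((b : ℝ) - 1) * (b - 2)) - (b - 1) * (b - 2) = (b - 1) * (b - 2) := by ring
  rw [e1, e2, e3, zero_sub, abs_neg, abs_neg]
  exact ⟨rfl, rfl⟩

/-- No two distinct vertices have a common neighbour, so everything is zero. -/
theorem cnEnergy_eq_of_card_two_one
    (h0 : Nat.card (f ⁻¹' {0}) = 2) (h1 : Nat.card (f ⁻¹' {1}) = 1) :
    Γ.cnEnergy = Γ.cnLaplacianEnergy ∧ Γ.cnLaplacianEnergy = Γ.cnSignlessLaplacianEnergy := by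
  have hD := cnDelta_of_cliques (b := 1) (m := 2) Γ f hΓ (by simp [h0])
    (fun j => by rw [Subsingleton.elim j 0]; exact h1) le_rfl (by norm_num)
  have hD : Γ.cnDelta = 0 := by push_cast at hD; linarith
  rw [cnEnergy_of_cliqueUnion Γ f hf hΓ, cnLaplacianEnergy_of_cliqueUnion Γ f hf hΓ,
    cnSignlessLaplacianEnergy_of_cliqueUnion Γ f hf hΓ]
  simp only [Fin.sum_univ_two, h0, h1, hD]
  norm_num

end

end SimpleGraph

/-! ### Counting fibres, conjugacy classes and reflections. -/

theorem Nat.card_preimage_of_card_fiber {α β : Type*} [Finite β] (g : α → β) (T : Set β) {s : ℕ}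
    (h : ∀ t ∈ T, Nat.card (g ⁻¹' {t}) = s) (hs : s ≠ 0) :
    Nat.card (g ⁻¹' T) = s * Nat.card T := by
  classical
  have := Fintype.ofFinite T
  let e : (Σ t : T, g ⁻¹' {(t : β)}) ≃ g ⁻¹' T :=
    { toFun := fun p => ⟨p.2.1, by
        have := p.2.2
        simp only [Set.mem_preimage, Set.mem_singleton_iff] at this
        simp [this]⟩
      invFun := fun x => ⟨⟨g x.1, x.2⟩, ⟨x.1, rfl⟩⟩
      left_inv := by
        rintro ⟨⟨t, ht⟩, ⟨x, hx⟩⟩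
        have h : g x = t := hx
        subst h; rfl
      right_inv := fun x => rfl }
  -- An infinite fibre would have `Nat.card` equal to 0, which `hs` excludes.
  have hfin : ∀ t : T, Finite (g ⁻¹' {(t : β)}) := fun t =>
    Nat.finite_of_card_ne_zero (by rw [h t t.2]; exact hs)
  rw [← Nat.card_congr e, Nat.card_sigma, Finset.sum_congr rfl fun t _ => h t.1 t.2]
  simp [mul_comm]

theorem ConjClasses.card_carrier_mul_card_centralizer {G : Type*} [Group G] [Finite G] (g : G) :
    Nat.card (ConjClasses.mk g).carrier * Nat.card (Subgroup.centralizer {g}) = Nat.card G := by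
  rw [Subgroup.nat_card_centralizer_nat_card_stabilizer, ← ConjAct.orbit_eq_carrier_conjClasses,
    ← Nat.card_prod, Nat.card_congr (MulAction.orbitProdStabilizerEquivGroup (ConjAct G) g)]
  rfl

namespace DihedralGroup

theorem isConj_sr_iff {n : ℕ} (i j : ZMod n) :
    IsConj (sr i) (sr j) ↔ ∃ c : ZMod n, j = i + 2 * c ∨ j = 2 * c - i := by
  rw [isConj_iff]
  constructor
  · rintro ⟨c | c, h⟩
    · exact ⟨-c, .inl (by simp at h; rw [← h]; ring)⟩
    · exact ⟨c, .inr (by simp at h; rw [← h]; ring)⟩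
  · rintro ⟨c, h | h⟩
    · exact ⟨r (-c), by simp [h]; ring⟩
    · exact ⟨sr c, by simp [h]; ring⟩

theorem sr_ne_one {n : ℕ} (i : ZMod n) : sr i ≠ 1 := by
  rw [one_def]
  exact nofun

theorem card_range_r (n : ℕ) : Nat.card (Set.range (r : ZMod n → DihedralGroup n)) = n := by
  rw [Nat.card_range_of_injective fun a b h => by simpa using h, Nat.card_zmod]

end DihedralGroup

/-! ### Commutation and centralizers in a group with dihedral central quotient. -/

open DihedralGroup

section

variable {G : Type*} [Group G] {n : ℕ} (φ : G →* DihedralGroup n)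
  (hφ : Function.Surjective φ) (hker : φ.ker = Subgroup.center G)

include hker in
theorem mem_center_of_map_eq {x y : G} (h : φ x = φ y) : x⁻¹ * y ∈ Subgroup.center G := by
  rw [← hker, MonoidHom.mem_ker, map_mul, map_inv, h, inv_mul_cancel]

include hker in
theorem commute_of_map_eq {x y : G} (h : φ x = φ y) : Commute x y := by
  have h1 := Subgroup.mem_center_iff.1 (mem_center_of_map_eq φ hker h) x
  have : Commute x (x * (x⁻¹ * y)) := (Commute.refl x).mul_right h1
  simpa using this

include hφ hker

theorem commute_of_map_eq_r {x y : G} {i j : ZMod n} (hx : φ x = r i) (hy : φ y = r j) :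
    Commute x y := by
  -- The preimage of the rotations is generated by ρ and the centre, hence abelian.
  obtain ⟨ρ, hρ⟩ := hφ (r 1)
  have key : ∀ {x : G} {i : ZMod n}, φ x = r i →
      ∃ k : ℤ, ∃ c ∈ Subgroup.center G, x = ρ ^ k * c := by
    intro x i hx
    obtain ⟨k, rfl⟩ := ZMod.intCast_surjective i
    refine ⟨k, _, mem_center_of_map_eq φ hker (x := ρ ^ k) (y := x) ?_, by group⟩
    rw [map_zpow, hρ, hx, r_zpow, one_mul]
  obtain ⟨k, c, hc, rfl⟩ := key hx
  obtain ⟨l, d, hd, rfl⟩ := key hy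
  have hc' : ∀ g, Commute g c := Subgroup.mem_center_iff.1 hc
  have hd' : ∀ g, Commute g d := Subgroup.mem_center_iff.1 hd
  exact ((((Commute.refl ρ).zpow_zpow k l).mul_right (hd' _))).mul_left ((hc' _).symm)

/-- The abelian preimage of the rotations together with y generates G, and x commutes with both. -/
theorem mem_center_of_commute {x y : G} {i j : ZMod n} (hx : φ x = r i) (hy : φ y = sr j)
    (h : Commute x y) : x ∈ Subgroup.center G := by
  rw [Subgroup.mem_center_iff]
  intro g
  rcases hg : φ g with k | k
  · exact commute_of_map_eq_r φ hφ hker hg hx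
  · have h1 : φ (y * g) = r (k - j) := by rw [map_mul, hg, hy, sr_mul_sr]
    have h2 : Commute x (y⁻¹ * (y * g)) :=
      h.inv_right.mul_right (commute_of_map_eq_r φ hφ hker hx h1)
    rw [inv_mul_cancel_left] at h2
    exact h2.symm

/-- The quotient of x and y lies over a rotation and commutes with x, so it is central. -/
theorem map_eq_of_commute {x y : G} {i j : ZMod n} (hx : φ x = sr i) (hy : φ y = sr j)
    (h : Commute x y) : φ x = φ y := by
  have h1 : φ (x⁻¹ * y) = r (j - i) := by rw [map_mul, map_inv, hx, hy, inv_sr, sr_mul_sr]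
  have h2 := mem_center_of_commute φ hφ hker h1 hx ((Commute.refl x).inv_left.mul_left h.symm)
  rw [← hker, MonoidHom.mem_ker, map_mul, map_inv] at h2
  exact inv_mul_eq_one.1 h2

variable [Finite G] [NeZero n]

theorem card_preimage_dihedral (T : Set (DihedralGroup n)) :
    Nat.card (φ ⁻¹' T) = Nat.card (Subgroup.center G) * Nat.card T := by
  refine Nat.card_preimage_of_card_fiber φ T (fun t _ => ?_) Nat.card_pos.ne'
  rw [Nat.card_congr (φ.fiberEquivKerOfSurjective hφ t), hker]

theorem card_eq_two_mul_mul : Nat.card G = Nat.card (Subgroup.center G) * (2 * n) := by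
  have := card_preimage_dihedral φ hφ hker Set.univ
  rw [Set.preimage_univ, Nat.card_univ, Nat.card_univ, DihedralGroup.nat_card] at this
  exact this

/-- The centralizer is the preimage of the rotation subgroup, of index 2. -/
theorem card_carrier_of_map_eq_r {x : G} {i : ZMod n} (hx : φ x = r i)
    (hxc : x ∉ Subgroup.center G) : Nat.card (ConjClasses.mk x).carrier = 2 := by
  have h1 : (Subgroup.centralizer {x} : Set G) = φ ⁻¹' (Set.range r) := by
    ext y
    rw [SetLike.mem_coe, Subgroup.mem_centralizer_singleton_iff]
    constructor
    · intro h
      rcases hy : φ y with j | j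
      · exact ⟨j, hy.symm⟩
      · exact (hxc (mem_center_of_commute φ hφ hker hx hy h.symm)).elim
    · rintro ⟨j, hj⟩
      exact commute_of_map_eq_r φ hφ hker hj.symm hx
  have h2 := card_preimage_dihedral φ hφ hker (Set.range r)
  rw [← h1, card_range_r] at h2
  have h3 := ConjClasses.card_carrier_mul_card_centralizer x
  rw [card_eq_two_mul_mul φ hφ hker] at h3
  change _ * Nat.card (Subgroup.centralizer {x} : Set G) = _ at h3
  rw [h2] at h3
  have : 0 < Nat.card (Subgroup.center G) * n := Nat.mul_pos Nat.card_pos (NeZero.pos n)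
  refine Nat.eq_of_mul_eq_mul_right this ?_
  rw [h3]; ring

/-- The centralizer is the preimage of a subgroup of order 2, so its index is n. -/
theorem card_carrier_of_map_eq_sr {x : G} {i : ZMod n} (hx : φ x = sr i) :
    Nat.card (ConjClasses.mk x).carrier = n := by
  have h1 : (Subgroup.centralizer {x} : Set G) = φ ⁻¹' {1, sr i} := by
    ext y
    rw [SetLike.mem_coe, Subgroup.mem_centralizer_singleton_iff]
    constructor
    · intro h
      rcases hy : φ y with j | j
      · have := mem_center_of_commute φ hφ hker hy hx h
        rw [← hker] at this
        exact .inl this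
      · exact .inr ((map_eq_of_commute φ hφ hker hy hx h).trans hx)
    · rintro (h | h)
      · have : y ∈ Subgroup.center G := by rw [← hker]; exact h
        exact (Subgroup.mem_center_iff.1 this x).symm
      · exact commute_of_map_eq φ hker (h.trans hx.symm)
  have h2 := card_preimage_dihedral φ hφ hker {1, sr i}
  rw [← h1, Nat.card_coe_set_eq {1, sr i}, Set.ncard_pair (sr_ne_one i).symm] at h2
  have h3 := ConjClasses.card_carrier_mul_card_centralizer x
  rw [card_eq_two_mul_mul φ hφ hker] at h3
  change _ * Nat.card (Subgroup.centralizer {x} : Set G) = _ at h3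
  rw [h2] at h3
  have : 0 < Nat.card (Subgroup.center G) * 2 := Nat.mul_pos Nat.card_pos two_pos
  refine Nat.eq_of_mul_eq_mul_right this ?_
  rw [h3]; ring

end

/-! ### The clique structure of the graph and the clique sizes. -/

section

variable {G : Type*} [Group G] {n k : ℕ} (φ : G →* DihedralGroup n)
  (τ : DihedralGroup n → Fin (k + 1))

/-- The map on noncentral conjugacy classes induced by a function on a dihedral quotient. -/
noncomputable def cccType (c : CCCVertex G) : Fin (k + 1) := τ (φ (Quotient.out c.1))

variable (hφ : Function.Surjective φ) (hker : φ.ker = Subgroup.center G)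
  (hr : ∀ i, τ (r i) = 0) (hsr : ∀ i, τ (sr i) ≠ 0)
  (hconj : ∀ i j, τ (sr i) = τ (sr j) ↔ IsConj (sr i) (sr j))

include hr hconj in
theorem dihedral_type_eq_of_isConj {g h : DihedralGroup n} (hgh : IsConj g h) : τ g = τ h := by
  obtain ⟨c, hc⟩ := isConj_iff.1 hgh
  rcases g with i | i <;> rcases h with j | j
  · rw [hr, hr]
  · rcases c with c | c <;> simp at hc
  · rcases c with c | c <;> simp at hc
  · exact (hconj i j).2 hgh

include hr hconj in
theorem cccType_eq (c : CCCVertex G) {x : G} (hx : ConjClasses.mk x = c.1) :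
    cccType φ τ c = τ (φ x) := by
  refine dihedral_type_eq_of_isConj τ hr hconj (φ.map_isConj ?_)
  rw [← ConjClasses.mk_eq_mk_iff_isConj, hx]
  exact Quotient.out_eq c.1

theorem CCCVertex.notMem_center (c : CCCVertex G) {x : G} (hx : ConjClasses.mk x = c.1) :
    x ∉ Subgroup.center G := by
  obtain ⟨y, hy, hyc⟩ := c.2
  rw [← hx, ConjClasses.mk_eq_mk_iff_isConj] at hyc
  intro h
  obtain ⟨g, hg⟩ := isConj_iff.1 hyc.symm
  rw [Subgroup.mem_center_iff.1 h g, mul_inv_cancel_right] at hg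
  exact hy (hg ▸ h)

include hφ hker hr hsr hconj

theorem cccGraph_adj_iff (u v : CCCVertex G) :
    (cccGraph G).Adj u v ↔ u ≠ v ∧ cccType φ τ u = cccType φ τ v := by
  change (u ≠ v ∧ ∃ x ∈ u.1.carrier, ∃ y ∈ v.1.carrier, Commute x y) ↔ _
  refine and_congr_right fun _ => ?_
  constructor
  · rintro ⟨x, hx, y, hy, h⟩
    rw [ConjClasses.mem_carrier_iff_mk_eq] at hx hy
    rw [cccType_eq φ τ hr hconj u hx, cccType_eq φ τ hr hconj v hy]
    rcases hx' : φ x with i | i <;> rcases hy' : φ y with j | j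
    · rw [hr, hr]
    · exact (u.notMem_center hx (mem_center_of_commute φ hφ hker hx' hy' h)).elim
    · exact (v.notMem_center hy (mem_center_of_commute φ hφ hker hy' hx' h.symm)).elim
    · rw [← hx', ← hy', map_eq_of_commute φ hφ hker hx' hy' h]
  · intro h
    obtain ⟨x, -, hx⟩ := u.2
    obtain ⟨y, -, hy⟩ := v.2
    rw [cccType_eq φ τ hr hconj u hx, cccType_eq φ τ hr hconj v hy] at h
    rcases hx' : φ x with i | i <;> rcases hy' : φ y with j | j <;> rw [hx', hy'] at h
    · exact ⟨x, ConjClasses.mem_carrier_iff_mk_eq.2 hx, y, ConjClasses.mem_carrier_iff_mk_eq.2 hy,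
        commute_of_map_eq_r φ hφ hker hx' hy'⟩
    · exact (hsr j (h.symm.trans (hr i))).elim
    · exact (hsr i (h.trans (hr j))).elim
    -- Conjugating x by a lift of c moves it over the same reflection as y, where elements differ by
    -- the centre and so commute.
    · obtain ⟨c, hc⟩ := isConj_iff.1 ((hconj i j).1 h)
      obtain ⟨g, rfl⟩ := hφ c
      refine ⟨g * x * g⁻¹, ConjClasses.mem_carrier_iff_mk_eq.2 ?_, y,
        ConjClasses.mem_carrier_iff_mk_eq.2 hy, commute_of_map_eq φ hker ?_⟩
      · rw [← hx, ConjClasses.mk_eq_mk_iff_isConj]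
        exact (isConj_iff.2 ⟨g, rfl⟩).symm
      · rw [map_mul, map_mul, map_inv, hx', hc, hy']

variable [Finite G] [NeZero n]

-- Class counts come from element counts: each class of type j contributes s elements, and elements
-- are easy to count in the quotient.
omit hφ hker hsr [NeZero n] in
theorem card_notMem_center_of_type (j : Fin (k + 1)) {s : ℕ} (hs : s ≠ 0)
    (h : ∀ x ∉ Subgroup.center G, τ (φ x) = j → Nat.card (ConjClasses.mk x).carrier = s) :
    Nat.card {x : G | x ∉ Subgroup.center G ∧ τ (φ x) = j} =
      s * Nat.card (cccType φ τ ⁻¹' {j} : Set (CCCVertex G)) := by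
  have e : {x : G | x ∉ Subgroup.center G ∧ τ (φ x) = j} =
      ConjClasses.mk ⁻¹' (Subtype.val '' (cccType φ τ ⁻¹' {j} : Set (CCCVertex G))) := by
    ext x
    simp only [Set.mem_ofPred_eq, Set.mem_preimage, Set.mem_image, Set.mem_singleton_iff]
    constructor
    · rintro ⟨hx, h⟩
      exact ⟨⟨ConjClasses.mk x, x, hx, rfl⟩, (cccType_eq φ τ hr hconj _ rfl).trans h, rfl⟩
    · rintro ⟨c, hc, hx⟩
      exact ⟨CCCVertex.notMem_center c hx.symm, (cccType_eq φ τ hr hconj c hx.symm).symm.trans hc⟩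
  rw [e, Nat.card_preimage_of_card_fiber ConjClasses.mk _ _ hs,
    Nat.card_image_of_injective Subtype.val_injective]
  rintro _ ⟨c, hc, rfl⟩
  obtain ⟨x, hx, hxc⟩ := c.2
  rw [← h x hx ((cccType_eq φ τ hr hconj c hxc).symm.trans hc), hxc]
  congr 2
  ext y
  exact ConjClasses.mem_carrier_iff_mk_eq.symm

theorem two_mul_card_type_zero :
    2 * Nat.card (cccType φ τ ⁻¹' {0} : Set (CCCVertex G)) =
      Nat.card (Subgroup.center G) * (n - 1) := by
  rw [← card_notMem_center_of_type φ τ hr hconj 0 two_ne_zero]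
  · have e : {x : G | x ∉ Subgroup.center G ∧ τ (φ x) = 0} = φ ⁻¹' (Set.range r \ {1}) := by
      ext x
      rw [← hker]
      simp only [Set.mem_ofPred_eq, Set.mem_preimage, Set.mem_sdiff, Set.mem_singleton_iff,
        MonoidHom.mem_ker, and_comm (a := ¬ φ x = 1)]
      refine and_congr_left fun _ => ?_
      rcases φ x with i | i
      · simp [hr]
      · simp [hsr]
    have h1 : Nat.card (Set.range r \ {1} : Set (DihedralGroup n)) = n - 1 := by
      rw [Nat.card_coe_set_eq, Set.ncard_sdiff_singleton_of_mem
        (show (1 : DihedralGroup n) ∈ Set.range r from ⟨0, rfl⟩), ← Nat.card_coe_set_eq,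
        card_range_r]
    rw [e, card_preimage_dihedral φ hφ hker, h1]
  · intro x hx h
    rcases hx' : φ x with i | i
    · exact card_carrier_of_map_eq_r φ hφ hker hx' hx
    · exact (hsr i (hx' ▸ h)).elim

omit hsr in
theorem mul_card_type_ne_zero {j : Fin (k + 1)} (hj : j ≠ 0) :
    n * Nat.card (cccType φ τ ⁻¹' {j} : Set (CCCVertex G)) =
      Nat.card (Subgroup.center G) * Nat.card {i : ZMod n | τ (sr i) = j} := by
  rw [← card_notMem_center_of_type φ τ hr hconj j (NeZero.ne n)]
  · have e : {x : G | x ∉ Subgroup.center G ∧ τ (φ x) = j} =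
        φ ⁻¹' (sr '' {i : ZMod n | τ (sr i) = j}) := by
      ext x
      rw [← hker]
      simp only [Set.mem_ofPred_eq, Set.mem_preimage, MonoidHom.mem_ker, Set.mem_image]
      rcases φ x with i | i
      · simp [hr, hj.symm]
      · simp [sr_ne_one]
    rw [e, card_preimage_dihedral φ hφ hker,
      Nat.card_image_of_injective fun a b h => by simpa using h]
  · intro x hx h
    rcases hx' : φ x with i | i
    · rw [hx', hr] at h
      exact (hj h.symm).elim
    · exact card_carrier_of_map_eq_sr φ hφ hker hx'

omit hsr in
/-- The number of classes of each type, when the `k` types of reflections are equally frequent. -/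
theorem card_type_succ (hk : ∀ j : Fin k, k * Nat.card {i : ZMod n | τ (sr i) = j.succ} = n)
    (j : Fin k) :
    k * Nat.card (cccType φ τ ⁻¹' {j.succ} : Set (CCCVertex G)) =
      Nat.card (Subgroup.center G) := by
  have h := mul_card_type_ne_zero φ τ hφ hker hr hconj (Fin.succ_ne_zero j)
  refine Nat.eq_of_mul_eq_mul_left (NeZero.pos n) ?_
  calc _ = k * (n * Nat.card (cccType φ τ ⁻¹' {j.succ} : Set (CCCVertex G))) := by ring
    _ = Nat.card (Subgroup.center G) * (k * Nat.card {i : ZMod n | τ (sr i) = j.succ}) := by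
      rw [h]; ring
    _ = _ := by rw [hk]; ring

theorem cccType_surjective (hn : 2 ≤ n)
    (hk : ∀ j : Fin k, k * Nat.card {i : ZMod n | τ (sr i) = j.succ} = n) :
    Function.Surjective (cccType φ τ : CCCVertex G → Fin (k + 1)) := by
  have hz : 0 < Nat.card (Subgroup.center G) := Nat.card_pos
  intro j
  have : 0 < Nat.card (cccType φ τ ⁻¹' {j} : Set (CCCVertex G)) := by
    rcases Fin.eq_zero_or_eq_succ j with rfl | ⟨j, rfl⟩
    · have h := two_mul_card_type_zero φ τ hφ hker hr hsr hconj
      have : 0 < Nat.card (Subgroup.center G) * (n - 1) := Nat.mul_pos hz (by omega)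
      omega
    · have h := card_type_succ φ τ hφ hker hr hconj hk j
      exact Nat.pos_of_mul_pos_left (h ▸ hz)
  obtain ⟨⟨c, hc⟩⟩ := (Nat.card_pos_iff.1 this).1
  exact ⟨c, hc⟩

end

/-! ### Conjugacy of reflections for odd and even n. -/

/-- Rotations against reflections. -/
def reflectionType {n : ℕ} : DihedralGroup n → Fin 2
  | r _ => 0
  | sr _ => 1

/-- Rotations against the two classes of reflections of a dihedral group with even parameter. -/
def reflectionParity {n : ℕ} : DihedralGroup n → Fin 3
  | r _ => 0
  | sr i => Fin.succ (i.cast : ZMod 2)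

/-- For odd n, 2 is a unit, so shifts by 2c reach every index. -/
theorem isConj_sr_of_odd {n : ℕ} (hn : Odd n) (i j : ZMod n) :
    IsConj (sr i : DihedralGroup n) (sr j) := by
  rw [isConj_sr_iff]
  have h2 : IsUnit (2 : ZMod n) := by
    have := (ZMod.isUnit_iff_coprime 2 n).2 (Nat.coprime_two_left.2 hn)
    exact_mod_cast this
  obtain ⟨c, hc⟩ := h2.dvd (a := j - i)
  exact ⟨c, .inl (by rw [← hc]; ring)⟩

theorem zmod_two_dvd_iff_castHom {n : ℕ} (hn : 2 ∣ n) (i : ZMod n) :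
    ZMod.castHom hn (ZMod 2) i = 0 ↔ ∃ c, i = 2 * c := by
  constructor
  · obtain ⟨k, rfl⟩ := ZMod.intCast_surjective i
    intro h
    rw [map_intCast, ZMod.intCast_zmod_eq_zero_iff_dvd] at h
    obtain ⟨c, rfl⟩ := h
    exact ⟨c, by push_cast; rfl⟩
  · rintro ⟨c, rfl⟩
    rw [map_mul, map_ofNat]
    exact mul_eq_zero_of_left (by decide) _

theorem reflectionParity_sr_eq_iff {n : ℕ} (hn : 2 ∣ n) (i j : ZMod n) :
    reflectionParity (sr i) = reflectionParity (sr j) ↔ IsConj (sr i) (sr j) := by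
  have h1 : reflectionParity (sr i) = reflectionParity (sr j) ↔
      ZMod.castHom hn (ZMod 2) (j - i) = 0 := by
    rw [map_sub, sub_eq_zero, eq_comm]
    -- `ZMod 2` unfolds to `Fin 2`, so equality of types is equality of residues mod 2.
    exact Fin.succ_inj
  rw [h1, isConj_sr_iff, zmod_two_dvd_iff_castHom hn]
  constructor
  · rintro ⟨c, hc⟩
    exact ⟨c, .inl (by rw [← hc]; ring)⟩
  · rintro ⟨c, h | h⟩
    · exact ⟨c, by rw [h]; ring⟩
    · exact ⟨c - i, by rw [h]; ring⟩

/-- Both parity classes are cosets of the kernel of reduction mod 2, which has index 2. -/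
theorem two_mul_card_reflectionParity {n : ℕ} [NeZero n] (hn : 2 ∣ n) (j : Fin 2) :
    2 * Nat.card {i : ZMod n | reflectionParity (sr i) = j.succ} = n := by
  let ψ : ZMod n →+ ZMod 2 := (ZMod.castHom hn (ZMod 2)).toAddMonoidHom
  have hψ : Function.Surjective ψ := ZMod.castHom_surjective hn
  have e : {i : ZMod n | reflectionParity (sr i) = j.succ} = ψ ⁻¹' {j} := by
    ext i
    exact Fin.succ_inj
  have h := AddSubgroup.card_eq_card_quotient_mul_card_addSubgroup ψ.ker
  rw [Nat.card_zmod, Nat.card_congr (QuotientAddGroup.quotientKerEquivOfSurjective ψ hψ).toEquiv,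
    Nat.card_zmod] at h
  rw [e]
  exact (congrArg (2 * ·) (Nat.card_congr (ψ.fiberEquivKerOfSurjective hψ j))).trans h.symm

/-! ### Assembly by the parity of n. -/

theorem mainTheorem5 (G : Type*) [Group G] [Finite G] (n z : ℕ) (hn : 3 ≤ n)
    (hz : Nat.card (Subgroup.center G) = z)
    (hG : Nonempty (G ⧸ Subgroup.center G ≃* DihedralGroup n)) :
    (((n = 3 ∧ 1 ≤ z) ∨ (n = 5 ∧ z = 1)) →
      (cccGraph G).cnEnergy = (cccGraph G).cnLaplacianEnergy ∧
      (cccGraph G).cnLaplacianEnergy = (cccGraph G).cnSignlessLaplacianEnergy) ∧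
    (¬ ((n = 3 ∧ 1 ≤ z) ∨ (n = 5 ∧ z = 1)) →
      (cccGraph G).cnEnergy < (cccGraph G).cnSignlessLaplacianEnergy ∧
      (cccGraph G).cnSignlessLaplacianEnergy < (cccGraph G).cnLaplacianEnergy) := by
  obtain ⟨e⟩ := hG
  have : NeZero n := ⟨by omega⟩
  have hz1 : 1 ≤ z := hz ▸ Nat.card_pos
  let φ : G →* DihedralGroup n := e.toMonoidHom.comp (QuotientGroup.mk' (Subgroup.center G))
  have hφ : Function.Surjective φ := e.surjective.comp (QuotientGroup.mk'_surjective _)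
  have hker : φ.ker = Subgroup.center G := by
    ext x
    simp [φ]
  rcases Nat.even_or_odd' n with ⟨l, hl | hl⟩
  · have hn2 : 2 ∣ n := ⟨l, hl⟩
    have hr : ∀ i : ZMod n, reflectionParity (r i) = 0 := fun _ => rfl
    have hsr : ∀ i : ZMod n, reflectionParity (sr i) ≠ 0 := fun _ => Fin.succ_ne_zero _
    have hconj := reflectionParity_sr_eq_iff hn2
    have hk := two_mul_card_reflectionParity hn2
    have hsurj := cccType_surjective φ reflectionParity hφ hker hr hsr hconj (by omega) hk
    have hadj := cccGraph_adj_iff φ reflectionParity hφ hker hr hsr hconj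
    have h0 := two_mul_card_type_zero φ reflectionParity hφ hker hr hsr hconj
    have h1 := card_type_succ φ reflectionParity hφ hker hr hconj hk
    rw [hz] at h0 h1
    refine ⟨fun h => by omega, fun _ => ?_⟩
    -- For even n, z is even because it is twice the number of classes over one parity of
    -- reflections.
    obtain ⟨b, hb⟩ : ∃ b, z = 2 * b := ⟨_, (h1 0).symm⟩
    refine (cccGraph G).cnEnergy_lt_of_cliques _ hsurj hadj (b := b) (m := (n : ℝ) - 1) ?_ ?_
      (.inr ⟨rfl, ?_⟩) (by omega)
    · have : Nat.card (cccType φ reflectionParity ⁻¹' {0} : Set (CCCVertex G)) = (n - 1) * b := by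
        rw [hb, mul_assoc] at h0
        rw [Nat.eq_of_mul_eq_mul_left two_pos h0, mul_comm]
      rw [this, Nat.cast_mul, Nat.cast_sub (by omega), Nat.cast_one]
    · intro j
      have := h1 j
      omega
    · have : (4 : ℝ) ≤ n := by exact_mod_cast (by omega : 4 ≤ n)
      linarith
  · have hr : ∀ i : ZMod n, reflectionType (r i) = 0 := fun _ => rfl
    have hsr : ∀ i : ZMod n, reflectionType (sr i) ≠ 0 := fun _ => one_ne_zero
    have hconj : ∀ i j : ZMod n, reflectionType (sr i) = reflectionType (sr j) ↔
        IsConj (sr i) (sr j) := fun i j => iff_of_true rfl (isConj_sr_of_odd ⟨l, hl⟩ i j)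
    have hk : ∀ j : Fin 1, 1 * Nat.card {i : ZMod n | reflectionType (sr i) = j.succ} = n := by
      intro j
      have : {i : ZMod n | reflectionType (sr i) = j.succ} = Set.univ :=
        Set.eq_univ_of_forall fun i => by rw [Subsingleton.elim j 0]; rfl
      rw [this, Nat.card_univ, Nat.card_zmod, one_mul]
    have hsurj := cccType_surjective φ reflectionType hφ hker hr hsr hconj (by omega) hk
    have hadj := cccGraph_adj_iff φ reflectionType hφ hker hr hsr hconj
    have h0 := two_mul_card_type_zero φ reflectionType hφ hker hr hsr hconj
    have h1 := card_type_succ φ reflectionType hφ hker hr hconj hk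
    rw [hz] at h0 h1
    have h0' : Nat.card (cccType φ reflectionType ⁻¹' {0} : Set (CCCVertex G)) = l * z := by
      refine Nat.eq_of_mul_eq_mul_left two_pos ?_
      rw [h0, hl, Nat.add_sub_cancel]; ring
    have h1' : ∀ j : Fin 1,
        Nat.card (cccType φ reflectionType ⁻¹' {j.succ} : Set (CCCVertex G)) = z := fun j => by
      rw [← h1 j, one_mul]
    constructor
    · rintro (⟨rfl, -⟩ | ⟨rfl, rfl⟩)
      · obtain rfl : l = 1 := by omega
        exact (cccGraph G).cnEnergy_eq_of_two_cliques _ hsurj hadj hz1 (by rw [h0', one_mul]) (h1' 0)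
      · obtain rfl : l = 2 := by omega
        exact (cccGraph G).cnEnergy_eq_of_card_two_one _ hsurj hadj (by rw [h0', mul_one]) (h1' 0)
    · intro h
      refine (cccGraph G).cnEnergy_lt_of_cliques _ hsurj hadj (b := z) (m := (l : ℝ))
        (by rw [h0', Nat.cast_mul]) h1' (.inl ⟨rfl, ?_⟩) hz1
      -- Here n = 2l + 1: l = 1 is the excluded n = 3, and l = 2 with z = 1 is the other exception.
      rcases (by omega : 3 ≤ l ∨ l = 2 ∧ 2 ≤ z) with h | ⟨h, h'⟩
      · exact .inl (by exact_mod_cast h)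
      · exact .inr ⟨by exact_mod_cast h, h'⟩
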